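/- For complex numbers $a,q$ with $|q|<1$ put $(a;q)_\infty=\prod_{n=0}^{\infty}(1-aq^n)$, and let $f(-q)=(q;q)_\infty$ and $\Phi(-q)=(-q;q)_\infty$. Then for every complex number $q$ with $|q|<1$, $$\frac{\Phi(-q)-f(-q)}{\Phi(-q)+f(-q)}=\cfrac{q}{1-q+\cfrac{q^3}{1-q^3+\cfrac{q^5}{1-q^5+\cfrac{q^7}{1-q^7+\cdots}}}}$$ in the following sense. Let $A_n/B_n$ be the $n$-th convergent of the continued fraction, where $A_{-1}=1$, $A_0=0$, $B_{-1}=0$, $B_0=1$ and $A_n=(1-q^{2n-1})A_{n-1}+q^{2n-1}A_{n-2}$, $B_n=(1-q^{2n-1})B_{n-1}+q^{2n-1}B_{n-2}$ for $n\ge 1$. Then $B_n\neq 0$ for all sufficiently large $n$. If $\Phi(-q)+f(-q)\neq 0$, then $A_n/B_n$ converges to the left-hand side; if $\Phi(-q)+f(-q)=0$, then $|A_n/B_n|\to\infty$, i.e. both sides equal $\infty$. -/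

import Mathlib

open Filter Topology

noncomputable section

/-- The finite `q`-Pochhammer symbol `(a;q)_k = ∏_{n=0}^{k-1} (1 - a qⁿ)`. -/
def qPoch (a q : ℂ) (k : ℕ) : ℂ := ∏ n ∈ Finset.range k, (1 - a * q ^ n)

/-- The infinite `q`-Pochhammer symbol `(a;q)_∞ = ∏_{n=0}^{∞} (1 - a qⁿ)`. -/
def qPochInf (a q : ℂ) : ℂ := ∏' n : ℕ, (1 - a * q ^ n)

/-- For `|q| < 1` the infinite product converges, and it is the limit of `(a;q)_k`. -/
theorem qPoch_tendsto_qPochInf (a q : ℂ) (hq : ‖q‖ < 1) :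
    Tendsto (qPoch a q) atTop (𝓝 (qPochInf a q)) := by
  have hs : Summable fun n : ℕ => ‖-(a * q ^ n)‖ := by
    simp only [norm_neg, norm_mul, norm_pow]
    exact (summable_geometric_of_lt_one (norm_nonneg q) hq).mul_left _
  have hm : Multipliable fun n : ℕ => (1 - a * q ^ n) := by
    simpa [sub_eq_add_neg] using multipliable_one_add_of_summable hs
  exact hm.hasProd.tendsto_prod_nat

/-- Ramanujan's `f`, normalised so that `f(-q) = (q;q)_∞`. -/
def ramanujanF (x : ℂ) : ℂ := qPochInf (-x) (-x)

/-- The function `Φ`, normalised so that `Φ(-q) = (-q;q)_∞`. -/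
def ramanujanPhi (x : ℂ) : ℂ := qPochInf x (-x)

theorem ramanujanF_neg (q : ℂ) : ramanujanF (-q) = qPochInf q q := by
  simp [ramanujanF]

theorem ramanujanPhi_neg (q : ℂ) : ramanujanPhi (-q) = qPochInf (-q) q := by
  simp [ramanujanPhi]

/-- The infinite continued fraction
`q/(1-q) + q³/(1-q³) + q⁵/(1-q⁵) + ⋯` (with head term `0`): the pair with index `n` has
partial numerator `q^(2n+1)` and partial denominator `1 - q^(2n+1)`. -/
def oddPowerCF (q : ℂ) : GenContFract ℂ where
  h := 0
  s := Stream'.Seq.ofStream fun n : ℕ =>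
    (⟨q ^ (2 * n + 1), 1 - q ^ (2 * n + 1)⟩ : GenContFract.Pair ℂ)

end

/-! Write `T_n` for the theta sum below. Each partial numerator and denominator add up to `1`, so
differences of consecutive `B_n` get multiplied by `-q^(2n-1)`; this forces `B_n = T_n` and `A_n = 1
- T_n`, and the convergents are `1/T_n - 1`. Gauss's identity gives `T_n → L = (Φ + f)/(2Φ)`, where
`Φ ≠ 0`. It is the limit of the exact finite identity `qPoch_mul_halfThetaSum`, whose right-hand sum
tends to `1`. When `L = 0`, the convergents go to `∞` provided `T_n ≠ 0` eventually. This holds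
because the first omitted theta term dominates the rest of the tail. -/

/-- The sum `1 + ∑_{k=1}^n (-1)^k q^{k²}`, a partial sum of `(1 + φ(-q)) / 2` for the theta function
`φ(-q) = ∑_{k ∈ ℤ} (-1)^k q^{k²}`. -/
noncomputable def halfThetaSum (q : ℂ) (n : ℕ) : ℂ := ∑ k ∈ Finset.range (n + 1), (-1) ^ k * q ^ k ^ 2

theorem halfThetaSum_zero (q : ℂ) : halfThetaSum q 0 = 1 := by simp [halfThetaSum]

theorem halfThetaSum_succ (q : ℂ) (n : ℕ) :
    halfThetaSum q (n + 1) = halfThetaSum q n + (-1) ^ (n + 1) * q ^ (n + 1) ^ 2 := by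
  simp [halfThetaSum, Finset.sum_range_succ]

theorem oddPowerCF_s_get? (q : ℂ) (n : ℕ) :
    (oddPowerCF q).s.get? n = some ⟨q ^ (2 * n + 1), 1 - q ^ (2 * n + 1)⟩ := rfl

/-- The denominators of the continued fraction are the partial theta sums. -/
theorem oddPowerCF_dens (q : ℂ) (n : ℕ) : (oddPowerCF q).dens n = halfThetaSum q n := by
  induction n using Nat.twoStepInduction with
  | zero => simp [halfThetaSum_zero]
  | one =>
    rw [GenContFract.first_den_eq (oddPowerCF_s_get? q 0), halfThetaSum_succ, halfThetaSum_zero]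
    ring
  | more n ih₁ ih₂ =>
    rw [GenContFract.dens_recurrence (oddPowerCF_s_get? q (n + 1)) ih₁ ih₂,
      halfThetaSum_succ q (n + 1), halfThetaSum_succ q n]
    ring

/-- The numerators and denominators of the continued fraction add up to `1`. -/
theorem oddPowerCF_nums (q : ℂ) (n : ℕ) : (oddPowerCF q).nums n = 1 - halfThetaSum q n := by
  induction n using Nat.twoStepInduction with
  | zero => simp [halfThetaSum_zero, oddPowerCF]
  | one =>
    rw [GenContFract.first_num_eq (oddPowerCF_s_get? q 0), halfThetaSum_succ, halfThetaSum_zero]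
    simp [oddPowerCF]
  | more n ih₁ ih₂ =>
    rw [GenContFract.nums_recurrence (oddPowerCF_s_get? q (n + 1)) ih₁ ih₂,
      halfThetaSum_succ q (n + 1), halfThetaSum_succ q n]
    ring

theorem qPoch_succ (a q : ℂ) (k : ℕ) : qPoch a q (k + 1) = qPoch a q k * (1 - a * q ^ k) :=
  Finset.prod_range_succ _ _

/-- The coefficient `(-1)^s (-1;q)_s / (q;q)_s` in the finite form of Gauss's identity. -/
noncomputable def gaussCoeff (q : ℂ) (s : ℕ) : ℂ := (-1) ^ s * qPoch (-1) q s / qPoch q q s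

theorem one_sub_pow_succ_ne_zero {q : ℂ} (hq : ‖q‖ < 1) (n : ℕ) : 1 - q ^ (n + 1) ≠ 0 := by
  intro h
  have h' : ‖q ^ (n + 1)‖ = 1 := by rw [← sub_eq_zero.mp h]; simp
  rw [norm_pow] at h'
  exact (pow_lt_one₀ (norm_nonneg q) hq n.succ_ne_zero).ne h'

theorem one_add_pow_succ_ne_zero {q : ℂ} (hq : ‖q‖ < 1) (n : ℕ) : 1 + q ^ (n + 1) ≠ 0 := by
  intro h
  have h' : ‖q ^ (n + 1)‖ = 1 := by rw [eq_neg_of_add_eq_zero_right h]; simp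
  rw [norm_pow] at h'
  exact (pow_lt_one₀ (norm_nonneg q) hq n.succ_ne_zero).ne h'

theorem qPoch_self_ne_zero {q : ℂ} (hq : ‖q‖ < 1) (n : ℕ) : qPoch q q n ≠ 0 :=
  Finset.prod_ne_zero_iff.mpr fun k _ => by
    simpa [pow_succ'] using one_sub_pow_succ_ne_zero hq k

theorem gaussCoeff_zero (q : ℂ) : gaussCoeff q 0 = 1 := by simp [gaussCoeff, qPoch]

theorem gaussCoeff_succ {q : ℂ} (hq : ‖q‖ < 1) (s : ℕ) :
    gaussCoeff q (s + 1) * (1 - q ^ (s + 1)) = -(gaussCoeff q s * (1 + q ^ s)) := by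
  have h₁ := qPoch_self_ne_zero hq s
  have h₂ := one_sub_pow_succ_ne_zero hq s
  rw [gaussCoeff, gaussCoeff, qPoch_succ, qPoch_succ, ← pow_succ' q s]
  field_simp
  ring

/-- Rests on `(-1;q)_{n+1} = 2 (-q;q)_n`. It matches the last term of the Gauss sum with the new
theta term. -/
theorem gaussCoeff_mul_qPoch {q : ℂ} (hq : ‖q‖ < 1) (n : ℕ) :
    gaussCoeff q n * qPoch q q n * (1 + q ^ n) = 2 * (-1) ^ n * qPoch (-q) q n := by
  have h : qPoch (-1) q n * (1 + q ^ n) = 2 * qPoch (-q) q n := by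
    induction n with
    | zero => norm_num [qPoch]
    | succ n ih =>
      rw [qPoch_succ, qPoch_succ]
      linear_combination (1 + q ^ (n + 1)) * ih
  rw [gaussCoeff, div_mul_cancel₀ _ (qPoch_self_ne_zero hq n)]
  linear_combination (-1) ^ n * h

/-- The bracket is `-(1 - q^s) - x(1 + q^s)`, so the coefficient recurrence makes the sum telescope.
This is the truncated form of `(1 - x) F(qx) = (1 + x) F(x)` for the generating function `F` of the
coefficients. -/
theorem sum_gaussCoeff_telescope {q : ℂ} (hq : ‖q‖ < 1) (x : ℂ) (m : ℕ) :
    ∑ s ∈ Finset.range (m + 1), gaussCoeff q s * x ^ s * (q ^ s * (1 - x) - (1 + x)) =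
      -(gaussCoeff q m * (1 + q ^ m) * x ^ (m + 1)) := by
  induction m with
  | zero => simp [gaussCoeff_zero]; ring
  | succ m ih =>
    rw [Finset.sum_range_succ, ih]
    linear_combination -x ^ (m + 1) * gaussCoeff_succ hq m

/-- A finite form of Gauss's identity `∑_{k ∈ ℤ} (-1)^k q^{k²} = (q;q)_∞ / (-q;q)_∞`. -/
theorem qPoch_mul_halfThetaSum {q : ℂ} (hq : ‖q‖ < 1) (n : ℕ) :
    qPoch (-q) q n * (2 * halfThetaSum q n - 1) =
      qPoch q q n * ∑ s ∈ Finset.range (n + 1), gaussCoeff q s * (q ^ (n + 1)) ^ s := by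
  induction n with
  | zero => simp [halfThetaSum_zero, gaussCoeff_zero, qPoch]; norm_num
  | succ n ih =>
    -- At `x = q^(n+1)` the functional equation links the sum for `n`, taken at `x`, to the sum for
    -- `n + 1`, taken at `qx`.
    have key := sum_gaussCoeff_telescope hq (q ^ (n + 1)) n
    have hsplit : ∑ s ∈ Finset.range (n + 1),
        gaussCoeff q s * (q ^ (n + 1)) ^ s * (q ^ s * (1 - q ^ (n + 1)) - (1 + q ^ (n + 1))) =
        (1 - q ^ (n + 1)) * ∑ s ∈ Finset.range (n + 1), gaussCoeff q s * (q ^ (n + 2)) ^ s -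
        (1 + q ^ (n + 1)) * ∑ s ∈ Finset.range (n + 1), gaussCoeff q s * (q ^ (n + 1)) ^ s := by
      rw [Finset.mul_sum, Finset.mul_sum, ← Finset.sum_sub_distrib]
      refine Finset.sum_congr rfl fun s _ => ?_
      rw [pow_succ q (n + 1), mul_pow]
      ring
    rw [hsplit] at key
    have hcoeff := gaussCoeff_succ hq n
    have hprod := gaussCoeff_mul_qPoch hq (n + 1)
    have hsq : q ^ (n + 1) ^ 2 = (q ^ (n + 1)) ^ (n + 1) := by rw [← pow_mul, sq]
    have hx : (q ^ (n + 2)) ^ (n + 1) = (q ^ (n + 1)) ^ (n + 1) * q ^ (n + 1) := by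
      rw [pow_succ q (n + 1), mul_pow]
    rw [qPoch_succ] at hprod
    rw [halfThetaSum_succ, Finset.sum_range_succ, qPoch_succ, qPoch_succ, hx, hsq]
    rw [qPoch_succ] at hprod
    have hp : q * q ^ n = q ^ (n + 1) := (pow_succ' q n).symm
    rw [neg_mul, hp] at hprod ⊢
    generalize (∑ s ∈ Finset.range (n + 1), gaussCoeff q s * (q ^ (n + 2)) ^ s) = S₂ at *
    generalize (∑ s ∈ Finset.range (n + 1), gaussCoeff q s * (q ^ (n + 1)) ^ s) = S₁ at *
    generalize (q ^ (n + 1)) ^ (n + 1) = y at *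
    linear_combination (1 + q ^ (n + 1)) * ih - qPoch q q n * key - y * hprod +
      qPoch q q n * y * hcoeff

/-- Consecutive coefficients have ratio at most `2 / (1 - ‖q‖)` in norm. Geometric growth is
harmless, as the argument `q^(n+1)` tends to `0`. -/
theorem norm_gaussCoeff_le {q : ℂ} (hq : ‖q‖ < 1) (s : ℕ) :
    ‖gaussCoeff q s‖ ≤ (2 / (1 - ‖q‖)) ^ s := by
  induction s with
  | zero => simp [gaussCoeff_zero]
  | succ s ih =>
    have hr : 0 < 1 - ‖q‖ := sub_pos.mpr hq
    have h := congrArg norm (gaussCoeff_succ hq s)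
    rw [norm_neg, norm_mul, norm_mul] at h
    have h₁ : 1 - ‖q‖ ≤ ‖1 - q ^ (s + 1)‖ := by
      have h₂ : ‖q‖ ^ (s + 1) ≤ ‖q‖ := pow_le_of_le_one (norm_nonneg q) hq.le s.succ_ne_zero
      have h₃ := norm_sub_norm_le (1 : ℂ) (q ^ (s + 1))
      rw [norm_one, norm_pow] at h₃
      linarith
    have h₂ : ‖1 + q ^ s‖ ≤ 2 := by
      have h₃ := norm_add_le (1 : ℂ) (q ^ s)
      rw [norm_one, norm_pow] at h₃
      linarith [pow_le_one₀ (n := s) (norm_nonneg q) hq.le]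
    rw [pow_succ, ← mul_div_assoc, le_div_iff₀ hr]
    calc ‖gaussCoeff q (s + 1)‖ * (1 - ‖q‖)
        ≤ ‖gaussCoeff q (s + 1)‖ * ‖1 - q ^ (s + 1)‖ := by gcongr
      _ = ‖gaussCoeff q s‖ * ‖1 + q ^ s‖ := h
      _ ≤ (2 / (1 - ‖q‖)) ^ s * 2 := by gcongr

theorem tendsto_sum_gaussCoeff {q : ℂ} (hq : ‖q‖ < 1) :
    Tendsto (fun n : ℕ => ∑ s ∈ Finset.range (n + 1), gaussCoeff q s * (q ^ (n + 1)) ^ s)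
      atTop (𝓝 1) := by
  set K : ℝ := 2 / (1 - ‖q‖) with hK
  have hK0 : 0 ≤ K := div_nonneg zero_le_two (sub_pos.mpr hq).le
  have hlim : Tendsto (fun n : ℕ => K * ‖q‖ ^ (n + 1)) atTop (𝓝 0) := by
    simpa using ((tendsto_pow_atTop_nhds_zero_of_lt_one (norm_nonneg q) hq).comp
      (tendsto_add_atTop_nat 1)).const_mul K
  rw [tendsto_iff_norm_sub_tendsto_zero]
  refine squeeze_zero' (Eventually.of_forall fun _ => norm_nonneg _) ?_
    (by simpa using hlim.mul_const 2)
  -- Once `t ≤ 1/2`, the terms beyond `s = 0` are dominated by `t · 2^(-s)`, with total at most `2t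
  -- → 0`.
  filter_upwards [hlim.eventually_le_const (show (0 : ℝ) < 1 / 2 by norm_num)] with n hn
  set t : ℝ := K * ‖q‖ ^ (n + 1) with ht
  have ht0 : 0 ≤ t := by positivity
  rw [Finset.sum_range_succ', gaussCoeff_zero, pow_zero, mul_one, add_sub_cancel_right]
  calc ‖∑ s ∈ Finset.range n, gaussCoeff q (s + 1) * (q ^ (n + 1)) ^ (s + 1)‖
      ≤ ∑ s ∈ Finset.range n, t * (1 / 2) ^ s := by
        refine norm_sum_le_of_le _ fun s _ => ?_
        rw [norm_mul, norm_pow, norm_pow]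
        calc ‖gaussCoeff q (s + 1)‖ * (‖q‖ ^ (n + 1)) ^ (s + 1)
            ≤ K ^ (s + 1) * (‖q‖ ^ (n + 1)) ^ (s + 1) := by
              gcongr; exact norm_gaussCoeff_le hq (s + 1)
          _ = t * t ^ s := by rw [← mul_pow, pow_succ']
          _ ≤ t * (1 / 2) ^ s := by gcongr
    _ = t * ∑ s ∈ Finset.range n, (1 / 2 : ℝ) ^ s := by rw [Finset.mul_sum]
    _ ≤ t * 2 := by gcongr; exact sum_geometric_two_le n

theorem qPochInf_neg_self_ne_zero {q : ℂ} (hq : ‖q‖ < 1) : qPochInf (-q) q ≠ 0 := by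
  have h := tprod_one_add_ne_zero_of_summable (f := fun n : ℕ => q ^ (n + 1))
    (one_add_pow_succ_ne_zero hq) (by
      simp only [norm_pow]
      exact (summable_nat_add_iff 1).mpr (summable_geometric_of_lt_one (norm_nonneg q) hq))
  simpa [qPochInf, pow_succ'] using h

/-- Gauss's identity, stated for `(1 + φ(-q)) / 2`. -/
theorem tendsto_halfThetaSum {q : ℂ} (hq : ‖q‖ < 1) :
    Tendsto (halfThetaSum q) atTop
      (𝓝 ((qPochInf (-q) q + qPochInf q q) / (2 * qPochInf (-q) q))) := by
  have hne := qPochInf_neg_self_ne_zero hq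
  have hPhi := qPoch_tendsto_qPochInf (-q) q hq
  have hlim := (((((qPoch_tendsto_qPochInf q q hq).mul (tendsto_sum_gaussCoeff hq)).div
    hPhi hne).const_add 1).div_const 2)
  have heq : (1 + qPochInf q q * 1 / qPochInf (-q) q) / 2 =
      (qPochInf (-q) q + qPochInf q q) / (2 * qPochInf (-q) q) := by
    field_simp
  rw [heq] at hlim
  refine hlim.congr' ?_
  filter_upwards [hPhi.eventually_ne hne] with n hn
  simp only [Pi.div_apply, ← qPoch_mul_halfThetaSum hq n]
  field_simp
  ring

theorem dist_halfThetaSum_succ (q : ℂ) (n : ℕ) :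
    dist (halfThetaSum q n) (halfThetaSum q (n + 1)) = ‖q‖ ^ (n + 1) ^ 2 := by
  rw [halfThetaSum_succ, dist_self_add_right]
  simp

/-- The partial theta sums are eventually nonzero, even when their limit vanishes. -/
theorem eventually_halfThetaSum_ne_zero {q : ℂ} (hq : ‖q‖ < 1) :
    ∀ᶠ n in atTop, halfThetaSum q n ≠ 0 := by
  have hlim := tendsto_halfThetaSum hq
  set L := (qPochInf (-q) q + qPochInf q q) / (2 * qPochInf (-q) q) with hL
  by_cases hL0 : L = 0
  swap
  · exact hlim.eventually_ne hL0
  have hq0 : q ≠ 0 := by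
    rintro rfl
    simp [hL, qPochInf] at hL0
  have hr : 0 < ‖q‖ := norm_pos_iff.mpr hq0
  -- If `T_n = 0`, then `‖T_{n+1}‖ = ‖q‖^((n+1)²)`. With ratio `1/4`, the steps after `T_{n+1}`
  -- total at most a third of this, so they cannot bring the limit to `0`.
  filter_upwards [(tendsto_pow_atTop_nhds_zero_of_lt_one (norm_nonneg q) hq).eventually_le_const
    (show (0 : ℝ) < 1 / 4 by norm_num)] with n hn h0
  have hstep : ∀ m : ℕ, dist (halfThetaSum q (m + (n + 1))) (halfThetaSum q (m + 1 + (n + 1))) ≤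
      ‖q‖ ^ (n + 1) ^ 2 / 4 * (1 / 4) ^ m := fun m => by
    rw [add_right_comm m 1 (n + 1), dist_halfThetaSum_succ]
    calc ‖q‖ ^ (m + (n + 1) + 1) ^ 2
        ≤ ‖q‖ ^ ((n + 1) ^ 2 + n * (m + 1)) :=
          pow_le_pow_of_le_one hr.le hq.le (by nlinarith)
      _ = ‖q‖ ^ (n + 1) ^ 2 * (‖q‖ ^ n) ^ (m + 1) := by rw [pow_add, pow_mul]
      _ ≤ ‖q‖ ^ (n + 1) ^ 2 * (1 / 4) ^ (m + 1) := by gcongr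
      _ = ‖q‖ ^ (n + 1) ^ 2 / 4 * (1 / 4) ^ m := by ring
  have hdist := dist_le_of_le_geometric_of_tendsto₀ (1 / 4) (‖q‖ ^ (n + 1) ^ 2 / 4)
    (by norm_num) hstep (hlim.comp (tendsto_add_atTop_nat (n + 1)))
  rw [hL0, dist_zero_right, zero_add, halfThetaSum_succ, h0, zero_add, norm_mul, norm_pow,
    norm_neg, norm_one, one_pow, one_mul, norm_pow] at hdist
  have hpos := pow_pos hr ((n + 1) ^ 2)
  rw [le_div_iff₀ (by norm_num)] at hdist
  linarith

/-- For `|q| < 1` the convergents `Aₙ / Bₙ` of the continued fraction are defined from some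
index on, and they converge, in the extended complex plane, to
`(Φ(-q) - f(-q)) / (Φ(-q) + f(-q))`; the value is `∞` where the denominator vanishes. -/
theorem proposition2 (q : ℂ) (hq : ‖q‖ < 1) :
    (∀ᶠ n in atTop, (oddPowerCF q).dens n ≠ 0) ∧
    (ramanujanPhi (-q) + ramanujanF (-q) ≠ 0 →
      Tendsto (fun n : ℕ => (oddPowerCF q).convs n) atTop
        (𝓝 ((ramanujanPhi (-q) - ramanujanF (-q)) / (ramanujanPhi (-q) + ramanujanF (-q))))) ∧
    (ramanujanPhi (-q) + ramanujanF (-q) = 0 →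
      Tendsto (fun n : ℕ => (oddPowerCF q).convs n) atTop (Bornology.cobounded ℂ)) := by
  have hne := qPochInf_neg_self_ne_zero hq
  have hlim := tendsto_halfThetaSum hq
  have hev := eventually_halfThetaSum_ne_zero hq
  have hconv : ∀ n, (oddPowerCF q).convs n = (1 - halfThetaSum q n) / halfThetaSum q n := fun n => by
    rw [GenContFract.conv_eq_num_div_den, oddPowerCF_nums, oddPowerCF_dens]
  simp only [oddPowerCF_dens, hconv, ramanujanPhi_neg, ramanujanF_neg]
  refine ⟨hev, fun h => ?_, fun h => ?_⟩
  · have hL : (qPochInf (-q) q + qPochInf q q) / (2 * qPochInf (-q) q) ≠ 0 :=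
      div_ne_zero h (mul_ne_zero two_ne_zero hne)
    have heq : (1 - (qPochInf (-q) q + qPochInf q q) / (2 * qPochInf (-q) q)) /
        ((qPochInf (-q) q + qPochInf q q) / (2 * qPochInf (-q) q)) =
        (qPochInf (-q) q - qPochInf q q) / (qPochInf (-q) q + qPochInf q q) := by
      field_simp
      ring
    exact heq ▸ (hlim.const_sub 1).div hlim hL
  · rw [h, zero_div] at hlim
    -- Inversion sends only punctured neighbourhoods of `0` to infinity (`0⁻¹ = 0`), so eventual
    -- nonvanishing is essential here.
    have hinv : Tendsto (fun n => (halfThetaSum q n)⁻¹) atTop (Bornology.cobounded ℂ) :=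
      tendsto_inv₀_nhdsNE_zero.comp (tendsto_nhdsWithin_iff.mpr ⟨hlim, hev⟩)
    refine ((tendsto_sub_const_cobounded (1 : ℂ)).comp hinv).congr' ?_
    filter_upwards [hev] with n hn
    simp [sub_div, hn]
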